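/- Let $G=(V,E)$, $E\subseteq V\times V$, be a finite directed graph; $d_{\mathrm{out}}(i)$ and $d_{\mathrm{in}}(j)$ denote the numbers of edges of $E$ leaving $i$ and entering $j$. \emph{Model.} The pairs $(p_i,q_i)_{i\in V}$ are i.i.d. from an arbitrary probability measure $\mu$ on $[0,1]^2$. Given these, the labels $y_{i,j}\in\{-1,+1\}$ of the edges $(i,j)\in E$ are independent, with $\Pr(y_{i,j}=1\mid p,q)=\eta(i,j):=\frac{p_i+q_j}{2}$. The Bayes optimal prediction is $y^*(i,j)=\mathrm{sgn}(\eta(i,j)-\frac12)$. \emph{Algorithm.} Let $\alpha\in(0,1)$ and $Q\in\mathbb R$. Let $E_L\subseteq E$ be a fixed set of edges with $|E_L|\ge 2Q/\alpha$ in which every node occurs at most once as origin and at most once as destination. Let $m$ be an integer with $\alpha|E|\le m\le|E|$, and let the training set $E_0$ be drawn uniformly without replacement from $E$, with $|E_0|=m$, independently of the parameters and labels. Let $\widehat{tr}(i)$ be the fraction of negative edges among the edges of $E_0$ leaving $i$, $\widehat{un}(j)$ the fraction of negative edges among the edges of $E_0$ entering $j$, and $\widehat\tau$ the fraction of positive edges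 in $E_L\cap E_0$ (a fraction over an empty set is $0$, and $\mathrm{sgn}(0)=0$). Each test edge $(i,j)\in E\setminus E_0$ is predicted as $$\widehat y(i,j)=\mathrm{sgn}\Big((1-\widehat{tr}(i))+(1-\widehat{un}(j))-\tfrac12-\widehat\tau\Big).$$ \emph{Theorem.} Probabilities below are over the parameters, the labels and $E_0$. (1) Let $0<\alpha,\delta<1$, $0<\varepsilon<\frac1{16}$ and $Q\ge\frac1{2\varepsilon^2}\ln\frac{4|V|}{\delta}$ (for $V=\emptyset$ read the logarithm as $0$). With probability at least $1-11\delta$, the equality $\widehat y(i,j)=y^*(i,j)$ holds simultaneously for all test edges $(i,j)\in E\setminus E_0$ with $d_{\mathrm{out}}(i)\ge 2Q/\alpha$, $d_{\mathrm{in}}(j)\ge 2Q/\alpha$ and $|\eta(i,j)-\frac12|>8\varepsilon$. (2) For all $\gamma,c>0$ there is a constant $C>0$, depending only on $\gamma$ and $c$, such that for every such graph, model, $\alpha\in(0,1)$, $E_L$, $m$ and every $Q\ge C\ln|V|$ (for $V=\emptyset$ read $\ln|V|$ and $|V|^{-c}$ as $0$): with probability at least $1-|V|^{-c}$, the equality $\widehat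 y(i,j)=y^*(i,j)$ holds simultaneously for all test edges $(i,j)\in E\setminus E_0$ with $d_{\mathrm{out}}(i)\ge\frac{C}{\alpha}\ln|V|$, $d_{\mathrm{in}}(j)\ge\frac C\alpha\ln|V|$ and $|\eta(i,j)-\frac12|\ge\gamma$. -/

import Mathlib

open MeasureTheory

namespace EdgeSign

/-- Latent parameters: every node `i` carries a pair `(p i, q i)` in `[0,1]²`. -/
abbrev Params (V : Type*) := V → unitInterval × unitInterval

section Degrees

variable {V : Type*} [DecidableEq V]

/-- The edges of `F` going out of `i`. -/
def outEdges (F : Finset (V × V)) (i : V) : Finset (V × V) := F.filter (fun e => e.1 = i)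

/-- The edges of `F` coming into `j`. -/
def inEdges (F : Finset (V × V)) (j : V) : Finset (V × V) := F.filter (fun e => e.2 = j)

/-- The fraction of the edges of `F` that carry the label `s` (`0` if `F` is empty). -/
noncomputable def fracLabel (F : Finset (V × V)) (y : V × V → SignType) (s : SignType) : ℝ :=
  ((F.filter (fun e => y e = s)).card : ℝ) / (F.card : ℝ)

/-- Trollness of `i` in the graph with edge set `F`: fraction of negative outgoing edges. -/
noncomputable def trollness (F : Finset (V × V)) (y : V × V → SignType) (i : V) : ℝ :=
  fracLabel (outEdges F i) y (-1)

/-- Untrustworthiness of `j` in the graph with edge set `F`: fraction of negative incoming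
edges. -/
noncomputable def untrust (F : Finset (V × V)) (y : V × V → SignType) (j : V) : ℝ :=
  fracLabel (inEdges F j) y (-1)

/-- The prediction of the threshold algorithm for the edge `e = (i, j)`, given the training edges
`E₀` (with their labels `y`) and the edge set `EL` used to estimate the threshold. -/
noncomputable def predict (EL E₀ : Finset (V × V)) (y : V × V → SignType) (e : V × V) : SignType :=
  SignType.sign ((1 - trollness E₀ y e.1) + (1 - untrust E₀ y e.2) - 1 / 2
    - fracLabel (EL ∩ E₀) y 1)

/-- `EL` is a set of edges in which each node occurs at most once as an origin and at most once as
a destination. -/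
def IsLinkSet (E EL : Finset (V × V)) : Prop :=
  EL ⊆ E ∧ Set.InjOn Prod.fst (EL : Set (V × V)) ∧ Set.InjOn Prod.snd (EL : Set (V × V))

end Degrees

section Model

variable {V : Type*}

/-- `η(i,j) = (p_i + q_j) / 2`, the probability of a positive label on `(i,j)`. -/
noncomputable def eta (x : Params V) (e : V × V) : ℝ :=
  (((x e.1).1 : ℝ) + ((x e.2).2 : ℝ)) / 2

/-- The Bayes optimal prediction `sgn (η(i,j) - 1/2)`. -/
noncomputable def bayes (x : Params V) (e : V × V) : SignType :=
  SignType.sign (eta x e - 1 / 2)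

/-- Probability of the label `s` on the edge `e`, given the parameters (labels are `±1`). -/
noncomputable def labelProb (x : Params V) (e : V × V) (s : SignType) : ℝ :=
  if s = 1 then eta x e else if s = -1 then 1 - eta x e else 0

/-- The random parameters `x`, labels `y` and training set `E₀` follow the generative model on the
directed graph with edge set `E`: the pairs `(p_i, q_i)` are i.i.d. with law `μ`; given the
parameters, the labels of the edges are independent, positive with probability `η`; and `E₀` is
independent of parameters and labels, and uniform among the `m`-element subsets of `E` (sampling
without replacement). The field `law` gives the joint law of the three objects. -/
structure IsModel [Fintype V] {Ω : Type*} [MeasurableSpace Ω]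
    (P : Measure Ω) (E : Finset (V × V)) (m : ℕ) (μ : Measure (unitInterval × unitInterval))
    (x : Ω → Params V) (y : Ω → V × V → SignType) (E₀ : Ω → Finset (V × V)) : Prop where
  measurable_params : Measurable x
  measurable_labels : ∀ e ∈ E, ∀ s, MeasurableSet {ω | y ω e = s}
  measurable_train : ∀ S, MeasurableSet {ω | E₀ ω = S}
  law : ∀ A : Set (Params V), MeasurableSet A → ∀ s : V × V → SignType,
    ∀ S ∈ E.powersetCard m,
      P {ω | x ω ∈ A ∧ (∀ e ∈ E, y ω e = s e) ∧ E₀ ω = S} =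
        (∫⁻ z in A, ∏ e ∈ E, ENNReal.ofReal (labelProb z e (s e)) ∂(Measure.pi fun _ : V => μ)) *
          ((E.card.choose m : ENNReal))⁻¹

end Model

end EdgeSign

namespace EdgeSign

/-! Write `a` and `b` for the means of `p` and `q` under `μ`. Among the training edges leaving `i`,
the destinations are distinct, so their `q`-values are i.i.d. and average to about `b`; hence `1 -
tr(i)` is about `(p_i + b)/2`. Likewise `1 - un(j)` is about `(a + q_j)/2`, and on the link set,
whose origins and destinations are all distinct, the threshold estimate is about `(a + b)/2`. The
unknown means cancel, and the predictor's argument is `η(i,j) - 1/2` up to three errors of `2ε`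
each, which a margin above `8ε` absorbs (`predict_eq_bayes`).

Each approximation needs three facts about an edge set `D`: at least `Q` of its edges are sampled (a
Chernoff bound for sampling without replacement, `card_filter_inter_lt_le`), the labels on the
sample concentrate given parameters and sample, and the parameters at its endpoints concentrate
(both by Hoeffding). `IsModel.measure_le` transfers conditional bounds to `P`. A union bound over
nodes finishes the proof. -/

lemma choose_sub_le_choose_mul_pow {N m : ℕ} (hm : m ≤ N) {t : ℕ} (ht : t ≤ N) :
    ((N - t).choose m : ℝ) ≤ N.choose m * (1 - m / N : ℝ) ^ t := by
  induction t with
  | zero => simp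
  | succ t ih =>
    have hN : (0 : ℝ) < N := by exact_mod_cast (by omega : 0 < N)
    have hθ : 0 ≤ 1 - (m / N : ℝ) := by
      rw [sub_nonneg, div_le_one hN]; exact_mod_cast hm
    obtain ⟨r, hr⟩ : ∃ r, N - t = r + 1 := ⟨N - t - 1, by omega⟩
    have hr' : N - (t + 1) = r := by omega
    have hrN : ((r : ℝ) + 1) ≤ N := by exact_mod_cast (by omega : r + 1 ≤ N)
    have ih := ih (by omega)
    rw [hr] at ih
    rw [hr', pow_succ, ← mul_assoc]
    refine le_trans ?_ (mul_le_mul_of_nonneg_right ih hθ)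
    rcases lt_or_ge r m with h | h
    · rw [Nat.choose_eq_zero_of_lt h]; push_cast; positivity
    -- One step multiplies the binomial coefficient by `1 - m/(r+1)`, which is at most `1 - m/N`
    -- because `r + 1 ≤ N`.
    · have h1 : (r.choose m : ℝ) * (r + 1) = (r + 1).choose m * (r + 1 - m) := by
        have := congrArg (Nat.cast (R := ℝ)) (Nat.choose_mul_succ_eq r m)
        rw [Nat.cast_mul, Nat.cast_mul, Nat.cast_sub (by omega)] at this
        push_cast at this; exact this
      have hr0 : (0 : ℝ) < r + 1 := by positivity
      rw [← mul_le_mul_iff_left₀ hr0, h1, mul_assoc]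
      refine mul_le_mul_of_nonneg_left ?_ (by positivity)
      have : (m : ℝ) * ((r + 1) / N) ≤ m * 1 := by
        gcongr; rwa [div_le_one hN]
      calc (r + 1 - m : ℝ) ≤ r + 1 - m * ((r + 1) / N) := by linarith
        _ = _ := by ring

/-! ### Lower tail of the number of sampled edges -/

section Hypergeometric

variable {β : Type*} [DecidableEq β]

/-- This compares a generating function of the hypergeometric law with the binomial one. Each factor
is `1/2 + 1/2 · 1[e ∉ S]`; expanding leaves the probabilities that `S` misses `T`, each at most `(1
- m/N)^|T|`, and the binomial expansion then folds back. -/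
lemma sum_powersetCard_half_pow_le {E D : Finset β} (hD : D ⊆ E) {m : ℕ} (hm : m ≤ E.card) :
    ∑ S ∈ E.powersetCard m, (1 / 2 : ℝ) ^ (D ∩ S).card ≤
      E.card.choose m * (1 - m / (2 * E.card) : ℝ) ^ D.card := by
  have key (S : Finset β) : (1 / 2 : ℝ) ^ (D ∩ S).card =
      ∑ T ∈ D.powerset, if Disjoint T S then (1 / 2 : ℝ) ^ D.card else 0 := by
    have h1 : (1 / 2 : ℝ) ^ (D ∩ S).card =
        ∏ e ∈ D, ((if e ∈ S then (0 : ℝ) else 1 / 2) + 1 / 2) := by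
      rw [← Finset.prod_const, ← Finset.filter_mem_eq_inter, Finset.prod_filter]
      refine Finset.prod_congr rfl fun e _ => ?_
      split_ifs <;> norm_num
    rw [h1, Finset.prod_add]
    refine Finset.sum_congr rfl fun T hT => ?_
    have hT := Finset.mem_powerset.1 hT
    split_ifs with h
    · have : ∏ e ∈ T, (if e ∈ S then (0 : ℝ) else 1 / 2) = ∏ e ∈ T, (1 / 2 : ℝ) :=
        Finset.prod_congr rfl fun e he => if_neg (Finset.disjoint_left.1 h he)
      rw [this, mul_comm, Finset.prod_sdiff hT, Finset.prod_const]
    · obtain ⟨e, he, heS⟩ := Finset.not_disjoint_iff.1 h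
      have : ∏ e ∈ T, (if e ∈ S then (0 : ℝ) else 1 / 2) = 0 :=
        Finset.prod_eq_zero he (by simp [heS])
      rw [this, zero_mul]
  simp_rw [key]
  rw [Finset.sum_comm]
  have h2 : (E.card.choose m : ℝ) * (1 - m / (2 * E.card) : ℝ) ^ D.card =
      ∑ T ∈ D.powerset, (1 / 2 : ℝ) ^ D.card * (E.card.choose m * (1 - m / E.card : ℝ) ^ T.card) := by
    have : (1 - m / (2 * E.card) : ℝ) ^ D.card =
        ∏ e ∈ D, ((1 / 2 : ℝ) * (1 - m / E.card) + 1 / 2) := by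
      rw [Finset.prod_const]; congr 1
      rcases eq_or_ne (E.card : ℝ) 0 with h | h
      · simp [h]; norm_num
      · field_simp; ring
    rw [this, Finset.prod_add, Finset.mul_sum]
    refine Finset.sum_congr rfl fun T hT => ?_
    have hT := Finset.mem_powerset.1 hT
    rw [Finset.prod_const, Finset.prod_const, mul_pow, Finset.card_sdiff_of_subset hT]
    have := pow_mul_pow_sub (1 / 2 : ℝ) (Finset.card_le_card hT)
    rw [← this]; ring
  rw [h2]
  refine Finset.sum_le_sum fun T hT => ?_
  have hT := (Finset.mem_powerset.1 hT).trans hD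
  rw [← Finset.sum_filter, Finset.sum_const, nsmul_eq_mul, mul_comm]
  refine mul_le_mul_of_nonneg_left ?_ (by positivity)
  have : (E.powersetCard m).filter (fun S => Disjoint T S) = (E \ T).powersetCard m := by
    ext S
    simp only [Finset.mem_filter, Finset.mem_powersetCard, Finset.subset_sdiff]
    rw [disjoint_comm]; tauto
  rw [this, Finset.card_powersetCard, Finset.card_sdiff_of_subset hT]
  exact choose_sub_le_choose_mul_pow hm (Finset.card_le_card hT)

/-- Markov's inequality for `(1/2)^|D ∩ S|`: its mean is at most `exp (-Q)`, while it exceeds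
`(1/2)^Q` on the bad samples. -/
lemma card_filter_inter_lt_le {E D : Finset β} (hD : D ⊆ E) {m : ℕ} (hm : m ≤ E.card)
    {α Q : ℝ} (hα : α * E.card ≤ m) (hE : 0 < E.card) (hQ : 0 ≤ Q) (hDQ : 2 * Q ≤ α * D.card) :
    (((E.powersetCard m).filter fun S => ((D ∩ S).card : ℝ) < Q).card : ℝ) ≤
      E.card.choose m * Real.exp (-(Q / 4)) := by
  have hE' : (0 : ℝ) < E.card := by exact_mod_cast hE
  set 𝒮 := (E.powersetCard m).filter fun S => ((D ∩ S).card : ℝ) < Q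
  have h1 : (𝒮.card : ℝ) * (1 / 2 : ℝ) ^ Q ≤
      E.card.choose m * (1 - m / (2 * E.card) : ℝ) ^ D.card := by
    refine le_trans ?_ (sum_powersetCard_half_pow_le hD hm)
    rw [← nsmul_eq_mul, ← Finset.sum_const]
    refine le_trans (Finset.sum_le_sum fun S hS => ?_)
      (Finset.sum_le_sum_of_subset_of_nonneg (Finset.filter_subset _ _) fun _ _ _ => by positivity)
    rw [← Real.rpow_natCast]
    exact Real.rpow_le_rpow_of_exponent_ge (by norm_num) (by norm_num)
      (Finset.mem_filter.1 hS).2.le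
  have h2 : (1 - m / (2 * E.card) : ℝ) ^ D.card ≤ Real.exp (-Q) := by
    have hα' : α ≤ m / E.card := by rwa [le_div_iff₀ hE']
    have hm' : (m : ℝ) / E.card ≤ 1 := by rw [div_le_one hE']; exact_mod_cast hm
    have hd : (m : ℝ) / (2 * E.card) = (m / E.card) / 2 := by field_simp
    calc _ ≤ Real.exp (-(m / (2 * E.card))) ^ D.card := by
          refine pow_le_pow_left₀ (by rw [hd]; linarith) ?_ _
          have := Real.add_one_le_exp (-(m / (2 * E.card : ℝ)))
          linarith
      _ = Real.exp (-((m / E.card) * D.card / 2)) := by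
          rw [← Real.exp_nat_mul, hd]; ring_nf
      _ ≤ _ := by
          rw [Real.exp_le_exp]
          have : α * D.card ≤ m / E.card * D.card := by gcongr
          linarith
  have h3 : (1 / 2 : ℝ) ^ Q = Real.exp (-(Real.log 2 * Q)) := by
    rw [Real.rpow_def_of_pos (by norm_num)]
    simp
  have h4 := Real.log_two_lt_d9
  rw [h3] at h1
  have h5 : (𝒮.card : ℝ) * Real.exp (-(Real.log 2 * Q)) ≤ E.card.choose m * Real.exp (-Q) :=
    h1.trans (by gcongr)
  calc (𝒮.card : ℝ) = 𝒮.card * Real.exp (-(Real.log 2 * Q)) * Real.exp (Real.log 2 * Q) := by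
        rw [mul_assoc, ← Real.exp_add]; simp
    _ ≤ E.card.choose m * Real.exp (-Q) * Real.exp (Real.log 2 * Q) := by gcongr
    _ ≤ _ := by
        -- The exponent is `-(1 - log 2) Q`, and `1 - log 2 > 1/4`.
        rw [mul_assoc, ← Real.exp_add]
        gcongr
        nlinarith

end Hypergeometric

/-! ### Hoeffding's inequality -/

open ProbabilityTheory in
/-- Hoeffding's inequality for the average of independent `[0,1]`-valued random variables. -/
lemma measureReal_sum_sub_integral_gt_le {Ω ι : Type*} [MeasurableSpace Ω] {P : Measure Ω}
    [IsProbabilityMeasure P] {X : ι → Ω → ℝ} (hind : iIndepFun X P) (hX : ∀ i, Measurable (X i))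
    (h01 : ∀ i ω, X i ω ∈ Set.Icc (0 : ℝ) 1) (s : Finset ι) {ε Q : ℝ} (hε : 0 < ε)
    (hQ : 0 < Q) (hs : Q ≤ s.card) :
    P.real {ω | ε * s.card < |∑ i ∈ s, (X i ω - ∫ a, X i a ∂P)|} ≤
      2 * Real.exp (-(2 * ε ^ 2 * Q)) := by
  have hk : (0 : ℝ) < s.card := hQ.trans_le hs
  have hc : ((‖(1 : ℝ) - 0‖₊ / 2) ^ 2 : NNReal) = 1 / 4 := by
    ext; norm_num
  have hsub (i : ι) : HasSubgaussianMGF (fun ω => X i ω - ∫ a, X i a ∂P) (1 / 4) P := by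
    rw [← hc]
    exact hasSubgaussianMGF_of_mem_Icc (hX i).aemeasurable (ae_of_all _ (h01 i))
  have hind1 : iIndepFun (fun i ω => X i ω - ∫ a, X i a ∂P) P :=
    hind.comp (fun i (r : ℝ) => r - ∫ a, X i a ∂P) fun i => by fun_prop
  have hind2 : iIndepFun (fun i ω => -(X i ω - ∫ a, X i a ∂P)) P :=
    hind1.comp (fun i (r : ℝ) => -r) fun i => by fun_prop
  -- With `k` summands of variance proxy `1/4`, the exponent is `(εk)²/(2 · k/4) = 2ε²k`, at least
  -- `2ε²Q`.
  have hb : Real.exp (-(ε * s.card) ^ 2 / (2 * ((∑ _i ∈ s, (1 / 4 : NNReal) : NNReal) : ℝ))) ≤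
      Real.exp (-(2 * ε ^ 2 * Q)) := by
    rw [Real.exp_le_exp]
    have : -(ε * s.card) ^ 2 / (2 * ((∑ _i ∈ s, (1 / 4 : NNReal) : NNReal) : ℝ)) =
        -(2 * ε ^ 2 * s.card) := by
      simp only [Finset.sum_const, nsmul_eq_mul]
      push_cast
      field_simp
      ring
    rw [this]
    gcongr
  have h0 : 0 ≤ ε * s.card := by positivity
  have h1 := (HasSubgaussianMGF.measure_sum_ge_le_of_iIndepFun hind1 (fun i _ => hsub i)
    (s := s) h0).trans hb
  have h2 := (HasSubgaussianMGF.measure_sum_ge_le_of_iIndepFun hind2 (fun i _ => (hsub i).neg)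
    (s := s) h0).trans hb
  have hsub : {ω | ε * s.card < |∑ i ∈ s, (X i ω - ∫ a, X i a ∂P)|} ⊆
      {ω | ε * s.card ≤ ∑ i ∈ s, (X i ω - ∫ a, X i a ∂P)} ∪
      {ω | ε * s.card ≤ ∑ i ∈ s, -(X i ω - ∫ a, X i a ∂P)} := by
    intro ω hω
    simp only [Set.mem_ofPred_eq, Set.mem_union, Finset.sum_neg_distrib] at hω ⊢
    exact (lt_abs.1 hω).imp le_of_lt le_of_lt
  exact (measureReal_mono hsub).trans ((measureReal_union_le _ _).trans (by linarith))

/-! ### Conditional law of the labels given the parameters -/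

section Labels

variable {V : Type*}

lemma eta_mem_Icc (z : Params V) (e : V × V) : eta z e ∈ Set.Icc (0 : ℝ) 1 := by
  have h1 := (z e.1).1.2
  have h2 := (z e.2).2.2
  simp only [Set.mem_Icc] at h1 h2
  constructor <;> unfold eta <;> linarith

lemma measurable_eta (e : V × V) : Measurable fun z : Params V => eta z e := by
  unfold eta
  fun_prop

lemma measurable_labelProb (e : V × V) (s : SignType) :
    Measurable fun z : Params V => labelProb z e s := by
  have := measurable_eta e
  unfold labelProb
  split_ifs <;> fun_prop

/-- The law of the sign of the edge `e` given the parameters, `true` standing for `+1`. -/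
noncomputable def edgeLaw (z : Params V) (e : V × V) : Measure Bool :=
  ENNReal.ofReal (eta z e) • Measure.dirac true +
    ENNReal.ofReal (1 - eta z e) • Measure.dirac false

instance (z : Params V) (e : V × V) : IsProbabilityMeasure (edgeLaw z e) := by
  have h := eta_mem_Icc z e
  constructor
  simp only [edgeLaw, Measure.add_apply, Measure.smul_apply, measure_univ, smul_eq_mul, mul_one]
  rw [← ENNReal.ofReal_add h.1 (by linarith [h.2])]
  simp

lemma edgeLaw_singleton (z : Params V) (e : V × V) (b : Bool) :
    edgeLaw z e {b} = ENNReal.ofReal (labelProb z e (if b then 1 else -1)) := by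
  cases b <;> simp [edgeLaw, labelProb]

lemma integral_edgeLaw (z : Params V) (e : V × V) :
    ∫ b, (if b then 1 else 0 : ℝ) ∂edgeLaw z e = eta z e := by
  have h := eta_mem_Icc z e
  rw [integral_fintype .of_finite]
  simp [measureReal_def, edgeLaw_singleton, labelProb, h.1]

/-- The joint law of the signs of the edges of `E` given the parameters. -/
noncomputable def labelLaw (E : Finset (V × V)) (z : Params V) : Measure (E → Bool) :=
  Measure.pi fun e : E => edgeLaw z e

instance (E : Finset (V × V)) (z : Params V) : IsProbabilityMeasure (labelLaw E z) := by
  unfold labelLaw; infer_instance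

variable [DecidableEq V]

/-- The labelling that is positive on the edges of `E` marked `true`, negative on those marked
`false`, and positive outside `E`. -/
def signLabel (E : Finset (V × V)) (b : E → Bool) (e : V × V) : SignType :=
  if h : e ∈ E then (if b ⟨e, h⟩ then 1 else -1) else 1

lemma signLabel_injOn {E : Finset (V × V)} {b b' : E → Bool}
    (h : ∀ e ∈ E, signLabel E b e = signLabel E b' e) : b = b' := by
  ext ⟨e, he⟩
  have := h e he
  simp only [signLabel, he, dif_pos] at this
  cases hb : b ⟨e, he⟩ <;> cases hb' : b' ⟨e, he⟩ <;> simp_all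

lemma labelLaw_singleton (E : Finset (V × V)) (z : Params V) (b : E → Bool) :
    labelLaw E z {b} = ∏ e ∈ E, ENNReal.ofReal (labelProb z e (signLabel E b e)) := by
  rw [labelLaw, Measure.pi_singleton, ← Finset.prod_coe_sort E]
  refine Finset.prod_congr rfl fun e _ => ?_
  rw [edgeLaw_singleton]
  simp [signLabel]

/-- Interchange of sum and integral. The set `A b` may depend on the labelling, so events that
couple labels and parameters are covered. -/
lemma sum_setLIntegral_labelProb (E : Finset (V × V)) (π : Measure (Params V))
    {A : (E → Bool) → Set (Params V)} (hA : ∀ b, MeasurableSet (A b)) :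
    ∑ b, ∫⁻ z in A b, ∏ e ∈ E, ENNReal.ofReal (labelProb z e (signLabel E b e)) ∂π =
      ∫⁻ z, labelLaw E z {b | z ∈ A b} ∂π := by
  classical
  have hm (b : E → Bool) : Measurable fun z : Params V =>
      ∏ e ∈ E, ENNReal.ofReal (labelProb z e (signLabel E b e)) :=
    Finset.measurable_fun_prod _ fun e _ => (measurable_labelProb e _).ennreal_ofReal
  simp_rw [← lintegral_indicator (hA _)]
  rw [← lintegral_finsetSum _ fun b _ => (hm b).indicator (hA b)]
  refine lintegral_congr fun z => ?_
  have : {b : E → Bool | z ∈ A b} = (Finset.univ.filter fun b => z ∈ A b : Finset (E → Bool)) := by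
    ext; simp
  rw [this, ← sum_measure_singleton, Finset.sum_filter]
  refine Finset.sum_congr rfl fun b _ => ?_
  rw [Set.indicator_apply, labelLaw_singleton]

end Labels

/-! ### From the joint law to conditional estimates -/

namespace IsModel

lemma measurableSet_atom {V : Type*} [Fintype V] {Ω : Type*} [MeasurableSpace Ω]
    {P : Measure Ω} {E : Finset (V × V)} {m : ℕ} {μ : Measure (unitInterval × unitInterval)}
    {x : Ω → Params V} {y : Ω → V × V → SignType} {E₀ : Ω → Finset (V × V)}
    (h : IsModel P E m μ x y E₀)
    {A : Set (Params V)} (hA : MeasurableSet A)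
    (s : V × V → SignType) (S : Finset (V × V)) :
    MeasurableSet {ω | x ω ∈ A ∧ (∀ e ∈ E, y ω e = s e) ∧ E₀ ω = S} := by
  have hy : MeasurableSet {ω | ∀ e ∈ E, y ω e = s e} := by
    have : {ω | ∀ e ∈ E, y ω e = s e} = ⋂ e ∈ E, {ω | y ω e = s e} := by ext; simp
    rw [this]
    exact Finset.measurableSet_biInter _ fun e he => h.measurable_labels e he _
  exact (h.measurable_params hA).inter (hy.inter (h.measurable_train S))

variable {V : Type*} [Fintype V] [DecidableEq V] {Ω : Type*} [MeasurableSpace Ω]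
  {P : Measure Ω} [IsProbabilityMeasure P] {E : Finset (V × V)} {m : ℕ}
  {μ : Measure (unitInterval × unitInterval)} [IsProbabilityMeasure μ]
  {x : Ω → Params V} {y : Ω → V × V → SignType} {E₀ : Ω → Finset (V × V)}

/-- Almost surely the training set has `m` edges of `E`, and all edges of `E` are labelled `±1`. -/
lemma ae_support (h : IsModel P E m μ x y E₀) (hm : m ≤ E.card) :
    ∀ᵐ ω ∂P, E₀ ω ∈ E.powersetCard m ∧ ∃ b, ∀ e ∈ E, y ω e = signLabel E b e := by
  set I : Finset ((E → Bool) × Finset (V × V)) := Finset.univ ×ˢ E.powersetCard m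
  set B : (E → Bool) × Finset (V × V) → Set Ω := fun i =>
    {ω | x ω ∈ Set.univ ∧ (∀ e ∈ E, y ω e = signLabel E i.1 e) ∧ E₀ ω = i.2}
  have hB (i) : MeasurableSet (B i) := h.measurableSet_atom .univ _ _
  -- The atoms are disjoint; for each of the `choose` many samples the label probabilities sum to
  -- one, so the atoms exhaust `P`.
  have hU : P (⋃ i ∈ I, B i) = 1 := by
    rw [measure_biUnion_finset _ fun i _ => hB i]
    · rw [Finset.sum_product_right]
      have : ∀ S ∈ E.powersetCard m, ∑ b, P (B (b, S)) = ((E.card.choose m : ENNReal))⁻¹ := by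
        intro S hS
        calc ∑ b, P (B (b, S)) = ∑ b, (∫⁻ z in Set.univ, ∏ e ∈ E,
              ENNReal.ofReal (labelProb z e (signLabel E b e)) ∂(Measure.pi fun _ : V => μ)) *
                ((E.card.choose m : ENNReal))⁻¹ :=
              Finset.sum_congr rfl fun b _ => h.law _ .univ _ S hS
          _ = _ := by
              rw [← Finset.sum_mul, sum_setLIntegral_labelProb E _ fun _ => .univ]
              simp
      rw [Finset.sum_congr rfl this, Finset.sum_const, Finset.card_powersetCard, nsmul_eq_mul]
      refine ENNReal.mul_inv_cancel ?_ (by simp)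
      exact_mod_cast (Nat.choose_pos hm).ne'
    · rintro ⟨b, S⟩ - ⟨b', S'⟩ - hne
      refine Set.disjoint_left.2 fun ω h1 h2 => hne ?_
      exact Prod.ext (signLabel_injOn fun e he => (h1.2.1 e he).symm.trans (h2.2.1 e he))
        (h1.2.2.symm.trans h2.2.2)
  have hc := (prob_compl_eq_zero_iff (Finset.measurableSet_biUnion _ fun i _ => hB i)).2 hU
  filter_upwards [compl_mem_ae_iff.2 hc] with ω hω
  rw [compl_compl] at hω
  simp only [Set.mem_iUnion] at hω
  obtain ⟨⟨b, S⟩, hi, -, hy, rfl⟩ := hω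
  exact ⟨(Finset.mem_product.1 hi).2, b, hy⟩

/-- An event of the model is bounded by averaging, over the training sets and the parameters, its
probability under the conditional law of the labels. -/
lemma measure_le (h : IsModel P E m μ x y E₀) (hm : m ≤ E.card)
    {B : Params V → (V × V → SignType) → Finset (V × V) → Prop}
    (hloc : ∀ z s s' S, S ⊆ E → (∀ e ∈ E, s e = s' e) → B z s S → B z s' S)
    (hmeas : ∀ b S, MeasurableSet {z | B z (signLabel E b) S}) :
    P {ω | B (x ω) (y ω) (E₀ ω)} ≤ (∑ S ∈ E.powersetCard m,
      ∫⁻ z, labelLaw E z {b | B z (signLabel E b) S} ∂(Measure.pi fun _ : V => μ)) *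
        ((E.card.choose m : ENNReal))⁻¹ := by
  -- The model prescribes the mass of atoms only, so the event is replaced, up to a null set, by the
  -- union of the atoms on which it holds. Labels off `E` are unconstrained, which is why `hloc` is
  -- required.
  set U : Set Ω := ⋃ S ∈ E.powersetCard m, ⋃ b ∈ (Finset.univ : Finset (E → Bool)),
    {ω | x ω ∈ {z | B z (signLabel E b) S} ∧ (∀ e ∈ E, y ω e = signLabel E b e) ∧ E₀ ω = S}
  have hU : P {ω | B (x ω) (y ω) (E₀ ω)} ≤ P U := by
    refine measure_mono_ae ?_
    filter_upwards [h.ae_support hm] with ω ⟨hS, b, hb⟩ hB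
    exact Set.mem_iUnion₂.2 ⟨E₀ ω, hS, Set.mem_iUnion₂.2 ⟨b, Finset.mem_univ _,
      hloc _ _ _ _ (Finset.mem_powersetCard.1 hS).1 hb hB, hb, rfl⟩⟩
  refine hU.trans ((measure_biUnion_finset_le _ _).trans ?_)
  rw [Finset.sum_mul]
  refine Finset.sum_le_sum fun S hS => (measure_biUnion_finset_le _ _).trans ?_
  rw [Finset.sum_congr rfl fun b _ => h.law _ (hmeas b S) _ S hS, ← Finset.sum_mul,
    sum_setLIntegral_labelProb E _ fun b => hmeas b S]
  rfl

lemma measureReal_le_of_forall (h : IsModel P E m μ x y E₀) (hm : m ≤ E.card)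
    {B : Params V → (V × V → SignType) → Finset (V × V) → Prop}
    (hloc : ∀ z s s' S, S ⊆ E → (∀ e ∈ E, s e = s' e) → B z s S → B z s' S)
    (hmeas : ∀ b S, MeasurableSet {z | B z (signLabel E b) S}) {t : ℝ} (ht : 0 ≤ t)
    (hB : ∀ S ⊆ E, ∫⁻ z, labelLaw E z {b | B z (signLabel E b) S} ∂(Measure.pi fun _ : V => μ) ≤
      ENNReal.ofReal t) :
    P.real {ω | B (x ω) (y ω) (E₀ ω)} ≤ t := by
  refine ENNReal.toReal_le_of_le_ofReal ht ((h.measure_le hm hloc hmeas).trans ?_)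
  calc _ ≤ (∑ S ∈ E.powersetCard m, ENNReal.ofReal t) * ((E.card.choose m : ENNReal))⁻¹ := by
        gcongr with S hS
        exact hB S (Finset.mem_powersetCard.1 hS).1
    _ = ENNReal.ofReal t * (E.card.choose m * ((E.card.choose m : ENNReal))⁻¹) := by
        rw [Finset.sum_const, Finset.card_powersetCard, nsmul_eq_mul]; ring
    _ ≤ _ := by
        rw [ENNReal.mul_inv_cancel _ (by simp), mul_one]
        exact_mod_cast (Nat.choose_pos hm).ne'

end IsModel

/-! ### Concentration events -/

section Estimates

variable {V : Type*}

/-- The edge set `F` has at least `Q` elements, and the number of positive labels on it is within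
`ε * F.card` of its expectation given the parameters. -/
def LabelsConcentrated (Q ε : ℝ) (F : Finset (V × V)) (z : Params V) (s : V × V → SignType) :
    Prop :=
  Q ≤ F.card ∧ |∑ e ∈ F, ((if s e = 1 then 1 else 0) - eta z e)| ≤ ε * F.card

/-- The average of `f` over the parameters of the nodes `g e`, `e ∈ F`, is `ε`-close to its mean. -/
def ParamsConcentrated (μ : Measure (unitInterval × unitInterval)) (ε : ℝ)
    (f : unitInterval × unitInterval → ℝ) (g : V × V → V) (F : Finset (V × V)) (z : Params V) :
    Prop :=
  |∑ e ∈ F, (f (z (g e)) - ∫ a, f a ∂μ)| ≤ ε * F.card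

lemma measurableSet_labelsConcentrated (Q ε : ℝ) (F : Finset (V × V)) (s : V × V → SignType) :
    MeasurableSet {z : Params V | LabelsConcentrated Q ε F z s} := by
  have h : Measurable fun z : Params V => ∑ e ∈ F, ((if s e = 1 then 1 else 0) - eta z e) :=
    Finset.measurable_fun_sum _ fun e _ => (measurable_eta e).const_sub _
  exact (MeasurableSet.const _).inter
    (measurableSet_le (continuous_abs.measurable.comp h) measurable_const)

lemma measurableSet_paramsConcentrated (μ : Measure (unitInterval × unitInterval)) (ε : ℝ)
    {f : unitInterval × unitInterval → ℝ} (hf : Measurable f) (g : V × V → V)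
    (F : Finset (V × V)) : MeasurableSet {z : Params V | ParamsConcentrated μ ε f g F z} := by
  have h : Measurable fun z : Params V => ∑ e ∈ F, (f (z (g e)) - ∫ a, f a ∂μ) :=
    Finset.measurable_fun_sum _ fun e _ => by fun_prop
  exact measurableSet_le (continuous_abs.measurable.comp h) measurable_const

end Estimates

/-! ### Probability that concentration fails -/

namespace IsModel

variable {V : Type*} [Fintype V] [DecidableEq V] {Ω : Type*} [MeasurableSpace Ω]
  {P : Measure Ω} [IsProbabilityMeasure P] {E : Finset (V × V)} {m : ℕ}
  {μ : Measure (unitInterval × unitInterval)} [IsProbabilityMeasure μ]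
  {x : Ω → Params V} {y : Ω → V × V → SignType} {E₀ : Ω → Finset (V × V)}

lemma measureReal_card_inter_lt_le (h : IsModel P E m μ x y E₀) (hm : m ≤ E.card)
    {α Q : ℝ} (hα : α * E.card ≤ m) (hE : 0 < E.card) (hQ : 0 ≤ Q) {D : Finset (V × V)}
    (hD : D ⊆ E) (hDQ : 2 * Q ≤ α * D.card) :
    P.real {ω | ((D ∩ E₀ ω).card : ℝ) < Q} ≤ Real.exp (-(Q / 4)) := by
  classical
  have h1 := h.measure_le hm (B := fun _ _ S => ((D ∩ S).card : ℝ) < Q)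
    (fun _ _ _ _ _ _ h => h) fun _ _ => .const _
  refine ENNReal.toReal_le_of_le_ofReal (Real.exp_pos _).le (h1.trans ?_)
  have h2 : ∑ S ∈ E.powersetCard m, ∫⁻ z, labelLaw E z {_b | ((D ∩ S).card : ℝ) < Q}
      ∂(Measure.pi fun _ : V => μ) =
      (((E.powersetCard m).filter fun S => ((D ∩ S).card : ℝ) < Q).card : ENNReal) := by
    rw [Finset.card_filter]
    push_cast
    refine Finset.sum_congr rfl fun S _ => ?_
    by_cases hS : ((D ∩ S).card : ℝ) < Q <;> simp [hS]
  have hC : (0 : ℝ) < E.card.choose m := by exact_mod_cast Nat.choose_pos hm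
  have h3 := card_filter_inter_lt_le hD hm hα hE hQ hDQ
  rw [h2, ← ENNReal.ofReal_natCast, ← ENNReal.ofReal_natCast, ← ENNReal.ofReal_inv_of_pos hC,
    ← ENNReal.ofReal_mul (by positivity)]
  refine ENNReal.ofReal_le_ofReal ?_
  rwa [← div_eq_mul_inv, div_le_iff₀ hC, mul_comm]

/-- Once parameters and sample are fixed, the labels are independent with means `eta`, so Hoeffding
applies. The guard `Q ≤ card` makes the bound uniform over samples. -/
lemma measureReal_labels_deviate_le (h : IsModel P E m μ x y E₀) (hm : m ≤ E.card)
    {ε Q : ℝ} (hε : 0 < ε) (hQ : 0 < Q) (D : Finset (V × V)) :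
    P.real {ω | Q ≤ (D ∩ E₀ ω).card ∧ ¬ LabelsConcentrated Q ε (D ∩ E₀ ω) (x ω) (y ω)} ≤
      2 * Real.exp (-(2 * ε ^ 2 * Q)) := by
  refine h.measureReal_le_of_forall hm
    (B := fun z s S => Q ≤ (D ∩ S).card ∧ ¬ LabelsConcentrated Q ε (D ∩ S) z s)
    ?_ ?_ (by positivity) ?_
  · intro z s s' S hS hs hB
    unfold LabelsConcentrated at hB ⊢
    rwa [Finset.sum_congr rfl fun e he => by
      rw [← hs e (hS (Finset.mem_inter.1 he).2)]]
  · intro b S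
    exact (MeasurableSet.const _).inter (measurableSet_labelsConcentrated Q ε _ _).compl
  · intro S hS
    by_cases hk : Q ≤ (D ∩ S).card
    swap
    · simp [hk]
    have hE : ∀ e ∈ D ∩ S, e ∈ E := fun e he => hS (Finset.mem_inter.1 he).2
    have hcard : ((D ∩ S).subtype (· ∈ E)).card = (D ∩ S).card := by
      rw [Finset.card_subtype, Finset.filter_true_of_mem hE]
    have key (z : Params V) :
        labelLaw E z {b | Q ≤ (D ∩ S).card ∧ ¬ LabelsConcentrated Q ε (D ∩ S) z (signLabel E b)} ≤
          ENNReal.ofReal (2 * Real.exp (-(2 * ε ^ 2 * Q))) := by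
      have hH := measureReal_sum_sub_integral_gt_le (P := labelLaw E z)
        (X := fun (e : E) (b : E → Bool) => if b e then 1 else 0)
        (ProbabilityTheory.iIndepFun_pi (X := fun _ (b : Bool) => if b then (1 : ℝ) else 0)
          fun _ => (measurable_of_finite _).aemeasurable)
        (fun e => measurable_of_finite _) (fun e b => by split_ifs <;> simp)
        ((D ∩ S).subtype (· ∈ E)) hε hQ (by rwa [hcard])
      rw [← ofReal_measureReal (by finiteness)]
      refine ENNReal.ofReal_le_ofReal (le_trans (measureReal_mono ?_) hH)
      rintro b ⟨-, hb⟩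
      simp only [LabelsConcentrated, hk, true_and, not_le] at hb
      have hint (e : E) : ∫ a, (if a e then 1 else 0 : ℝ) ∂labelLaw E z = eta z e := by
        rw [← integral_edgeLaw]
        exact integral_comp_eval (μ := fun e : E => edgeLaw z e)
          (f := fun b : Bool => if b then (1 : ℝ) else 0)
          (measurable_of_finite _).aestronglyMeasurable
      have hsum : ∑ e ∈ (D ∩ S).subtype (· ∈ E),
          ((if b e then (1 : ℝ) else 0) - ∫ a, (if a e then 1 else 0 : ℝ) ∂labelLaw E z) =
          ∑ e ∈ D ∩ S, ((if signLabel E b e = 1 then 1 else 0) - eta z e) := by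
        rw [← Finset.sum_subtype_of_mem _ hE]
        refine Finset.sum_congr rfl fun e _ => ?_
        rw [hint]
        cases hbe : b e <;> simp [signLabel, hbe]
      rw [Set.mem_ofPred_eq, hsum, hcard]
      exact hb
    refine (lintegral_mono key).trans ?_
    simp

/-- Injectivity of `g` on `D` makes the summands functions of distinct nodes, hence independent;
fixing the sample does not alter the law of the parameters. -/
lemma measureReal_params_deviate_le (h : IsModel P E m μ x y E₀) (hm : m ≤ E.card)
    {ε Q : ℝ} (hε : 0 < ε) (hQ : 0 < Q) {D : Finset (V × V)}
    {f : unitInterval × unitInterval → ℝ} (hf : Measurable f) (hf01 : ∀ a, f a ∈ Set.Icc (0 : ℝ) 1)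
    {g : V × V → V} (hg : Set.InjOn g (D : Set (V × V))) :
    P.real {ω | Q ≤ (D ∩ E₀ ω).card ∧ ¬ ParamsConcentrated μ ε f g (D ∩ E₀ ω) (x ω)} ≤
      2 * Real.exp (-(2 * ε ^ 2 * Q)) := by
  have hms (S : Finset (V × V)) : MeasurableSet {z : Params V |
      Q ≤ (D ∩ S).card ∧ ¬ ParamsConcentrated μ ε f g (D ∩ S) z} :=
    (MeasurableSet.const _).inter (measurableSet_paramsConcentrated μ ε hf g _).compl
  refine h.measureReal_le_of_forall hm
    (B := fun z _ S => Q ≤ (D ∩ S).card ∧ ¬ ParamsConcentrated μ ε f g (D ∩ S) z)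
    (fun _ _ _ _ _ _ h => h) (fun _ S => hms S) (by positivity) ?_
  intro S hS
  by_cases hk : Q ≤ (D ∩ S).card
  swap
  · simp [hk]
  have hg' : Set.InjOn g ((D ∩ S : Finset (V × V)) : Set (V × V)) :=
    hg.mono (by exact_mod_cast Finset.inter_subset_left)
  have hcard : ((D ∩ S).image g).card = (D ∩ S).card := Finset.card_image_of_injOn hg'
  have hH := measureReal_sum_sub_integral_gt_le (P := Measure.pi fun _ : V => μ)
    (X := fun (v : V) (z : Params V) => f (z v))
    (ProbabilityTheory.iIndepFun_pi (X := fun _ => f) fun _ => hf.aemeasurable)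
    (fun v => by fun_prop) (fun v z => hf01 _) ((D ∩ S).image g) hε hQ (by rwa [hcard])
  calc ∫⁻ z, labelLaw E z {_b | Q ≤ (D ∩ S).card ∧ ¬ ParamsConcentrated μ ε f g (D ∩ S) z}
        ∂(Measure.pi fun _ : V => μ)
      = ∫⁻ z, Set.indicator {z | Q ≤ (D ∩ S).card ∧ ¬ ParamsConcentrated μ ε f g (D ∩ S) z} 1 z
        ∂(Measure.pi fun _ : V => μ) := by
        refine lintegral_congr fun z => ?_
        by_cases hz : Q ≤ (D ∩ S).card ∧ ¬ ParamsConcentrated μ ε f g (D ∩ S) z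
        · simp [hz]
        · refine Eq.trans ?_ (Set.indicator_of_notMem (Set.mem_ofPred_eq ▸ hz) _).symm
          simp [hz]
    _ = (Measure.pi fun _ : V => μ)
          {z | Q ≤ (D ∩ S).card ∧ ¬ ParamsConcentrated μ ε f g (D ∩ S) z} :=
        lintegral_indicator_one (hms S)
    _ ≤ _ := by
        rw [← ofReal_measureReal (by finiteness)]
        refine ENNReal.ofReal_le_ofReal (le_trans (measureReal_mono ?_) hH)
        rintro z ⟨-, hz⟩
        have hint (v : V) : ∫ a : Params V, f (a v) ∂(Measure.pi fun _ : V => μ) = ∫ a, f a ∂μ :=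
          integral_comp_eval (μ := fun _ : V => μ) hf.aestronglyMeasurable
        rw [Set.mem_ofPred_eq, hcard, Finset.sum_image hg']
        simp_rw [hint]
        exact not_le.1 hz

lemma measureReal_not_labelsConcentrated_le (h : IsModel P E m μ x y E₀) (hm : m ≤ E.card)
    {α ε Q : ℝ} (hα : α * E.card ≤ m) (hE : 0 < E.card) (hε : 0 < ε) (hε' : 2 * ε ^ 2 ≤ 1 / 4)
    (hQ : 0 < Q) {D : Finset (V × V)} (hD : D ⊆ E) (hDQ : 2 * Q ≤ α * D.card) :
    P.real {ω | ¬ LabelsConcentrated Q ε (D ∩ E₀ ω) (x ω) (y ω)} ≤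
      3 * Real.exp (-(2 * ε ^ 2 * Q)) := by
  have h1 := h.measureReal_card_inter_lt_le hm hα hE hQ.le hD hDQ
  have h2 := h.measureReal_labels_deviate_le hm hε hQ D
  -- The assumption `2ε² ≤ 1/4` lets the sampling tail be absorbed into the Hoeffding tail, so the
  -- constant is `1 + 2`.
  have h3 : Real.exp (-(Q / 4)) ≤ Real.exp (-(2 * ε ^ 2 * Q)) := by
    rw [Real.exp_le_exp]; nlinarith
  refine (measureReal_mono (s₂ := {ω | ((D ∩ E₀ ω).card : ℝ) < Q} ∪
    {ω | Q ≤ (D ∩ E₀ ω).card ∧ ¬ LabelsConcentrated Q ε (D ∩ E₀ ω) (x ω) (y ω)}) ?_).trans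
    ((measureReal_union_le _ _).trans (by linarith))
  intro ω hω
  rcases lt_or_ge ((D ∩ E₀ ω).card : ℝ) Q with hk | hk
  · exact Or.inl hk
  · exact Or.inr ⟨hk, hω⟩

/-- Training edges in `D` are numerous, and both their labels and the parameters at their endpoints
`g` concentrate. -/
lemma measureReal_not_concentrated_le (h : IsModel P E m μ x y E₀) (hm : m ≤ E.card)
    {α ε Q : ℝ} (hα : α * E.card ≤ m) (hE : 0 < E.card) (hε : 0 < ε) (hε' : 2 * ε ^ 2 ≤ 1 / 4)
    (hQ : 0 < Q) {D : Finset (V × V)} (hD : D ⊆ E) (hDQ : 2 * Q ≤ α * D.card)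
    {f : unitInterval × unitInterval → ℝ} (hf : Measurable f) (hf01 : ∀ a, f a ∈ Set.Icc (0 : ℝ) 1)
    {g : V × V → V} (hg : Set.InjOn g (D : Set (V × V))) :
    P.real {ω | ¬ (LabelsConcentrated Q ε (D ∩ E₀ ω) (x ω) (y ω) ∧
      ParamsConcentrated μ ε f g (D ∩ E₀ ω) (x ω))} ≤ 5 * Real.exp (-(2 * ε ^ 2 * Q)) := by
  have h1 := h.measureReal_not_labelsConcentrated_le hm hα hE hε hε' hQ hD hDQ
  have h2 := h.measureReal_params_deviate_le hm hε hQ hf hf01 hg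
  refine (measureReal_mono (s₂ :=
    {ω | ¬ LabelsConcentrated Q ε (D ∩ E₀ ω) (x ω) (y ω)} ∪
    {ω | Q ≤ (D ∩ E₀ ω).card ∧ ¬ ParamsConcentrated μ ε f g (D ∩ E₀ ω) (x ω)}) ?_).trans
    ((measureReal_union_le _ _).trans (by linarith))
  intro ω hω
  by_cases hl : LabelsConcentrated Q ε (D ∩ E₀ ω) (x ω) (y ω)
  · exact Or.inr ⟨hl.1, fun hp => hω ⟨hl, hp⟩⟩
  · exact Or.inl hl

end IsModel

/-! ### Concentration forces the Bayes prediction -/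

section Deterministic

variable {V : Type*}

lemma fracLabel_one_eq (F : Finset (V × V)) (y : V × V → SignType) :
    fracLabel F y 1 = (∑ e ∈ F, (if y e = 1 then 1 else 0 : ℝ)) / F.card := by
  rw [fracLabel, Finset.card_filter]
  push_cast
  rfl

/-- Nonemptiness matters: on an empty set both fractions are `0` by convention. -/
lemma one_sub_fracLabel_neg_one {F : Finset (V × V)} {y : V × V → SignType}
    (hF : 0 < (F.card : ℝ)) (hy : ∀ e ∈ F, y e ≠ 0) : 1 - fracLabel F y (-1) = fracLabel F y 1 := by
  have h : (F.filter fun e => ¬ y e = -1) = F.filter fun e => y e = 1 := by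
    refine Finset.filter_congr fun e he => ?_
    have := hy e he
    cases hye : y e <;> simp_all
  have hc := Finset.card_filter_add_card_filter_not (s := F) (fun e => y e = -1)
  rw [h] at hc
  have hc' : ((F.filter fun e => y e = -1).card : ℝ) + (F.filter fun e => y e = 1).card = F.card := by
    exact_mod_cast hc
  rw [fracLabel, fracLabel, eq_div_iff hF.ne', sub_mul, div_mul_cancel₀ _ hF.ne']
  linarith

/-- The fraction of positive labels on `F` is close to the mean of `(p + q) / 2`, as soon as the
labels and both families of parameters concentrate. -/
lemma abs_fracLabel_one_sub_le {Q ε a b : ℝ} {F : Finset (V × V)} {z : Params V}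
    {y : V × V → SignType} (hQ : 0 < Q) (h : LabelsConcentrated Q ε F z y)
    (ha : |∑ e ∈ F, (((z e.1).1 : ℝ) - a)| ≤ ε * F.card)
    (hb : |∑ e ∈ F, (((z e.2).2 : ℝ) - b)| ≤ ε * F.card) :
    |fracLabel F y 1 - (a + b) / 2| ≤ 2 * ε := by
  have hF : (0 : ℝ) < F.card := hQ.trans_le h.1
  -- Label noise contributes `ε`, and each of the two halved parameter deviations contributes `ε/2`.
  have h1 : fracLabel F y 1 - (a + b) / 2 =
      (∑ e ∈ F, ((if y e = 1 then 1 else 0) - eta z e) + (∑ e ∈ F, (((z e.1).1 : ℝ) - a)) / 2 +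
        (∑ e ∈ F, (((z e.2).2 : ℝ) - b)) / 2) / F.card := by
    rw [fracLabel_one_eq, Finset.sum_div, Finset.sum_div F (fun e => ((z e.1).1 : ℝ) - a),
      Finset.sum_div F (fun e => ((z e.2).2 : ℝ) - b), ← Finset.sum_add_distrib,
      ← Finset.sum_add_distrib]
    have : ∀ e ∈ F, ((if y e = 1 then 1 else 0) - eta z e) + (((z e.1).1 : ℝ) - a) / 2 +
        (((z e.2).2 : ℝ) - b) / 2 = (if y e = 1 then 1 else 0) - (a + b) / 2 := by
      intro e _; unfold eta; ring
    rw [Finset.sum_congr rfl this, Finset.sum_sub_distrib, ← Finset.sum_div, Finset.sum_const,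
      nsmul_eq_mul]
    field_simp
  rw [h1, abs_div, abs_of_pos hF, div_le_iff₀ hF]
  have h2 := h.2
  rw [abs_le] at *
  constructor <;> linarith [h2.1, h2.2, ha.1, ha.2, hb.1, hb.2]

lemma sign_eq_sign_of_abs_sub_lt {a b : ℝ} (h : |a - b| < |b|) :
    SignType.sign a = SignType.sign b := by
  rcases lt_trichotomy b 0 with hb | hb | hb
  · rw [abs_of_neg hb, abs_lt] at h
    rw [sign_neg hb, sign_neg (by linarith)]
  · simp [hb] at h
    exact absurd h (not_lt.2 (abs_nonneg _))
  · rw [abs_of_pos hb, abs_lt] at h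
    rw [sign_pos hb, sign_pos (by linarith)]

lemma predict_eq_bayes [DecidableEq V] {μ : Measure (unitInterval × unitInterval)} {Q ε : ℝ} (hQ : 0 < Q)
    {E EL S : Finset (V × V)} (hS : S ⊆ E) {z : Params V} {y : V × V → SignType}
    (hy : ∀ e ∈ E, y e ≠ 0) {e : V × V}
    (hout : LabelsConcentrated Q ε (outEdges E e.1 ∩ S) z y)
    (hout' : ParamsConcentrated μ ε (fun a => a.2) Prod.snd (outEdges E e.1 ∩ S) z)
    (hin : LabelsConcentrated Q ε (inEdges E e.2 ∩ S) z y)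
    (hin' : ParamsConcentrated μ ε (fun a => a.1) Prod.fst (inEdges E e.2 ∩ S) z)
    (hL : LabelsConcentrated Q ε (EL ∩ S) z y)
    (hL₁ : ParamsConcentrated μ ε (fun a => a.1) Prod.fst (EL ∩ S) z)
    (hL₂ : ParamsConcentrated μ ε (fun a => a.2) Prod.snd (EL ∩ S) z)
    (hε : 0 < ε) (he : 8 * ε < |eta z e - 1 / 2|) : predict EL S y e = bayes z e := by
  have ho : outEdges E e.1 ∩ S = outEdges S e.1 := by
    ext a; simp only [outEdges, Finset.mem_inter, Finset.mem_filter]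
    exact ⟨fun h => ⟨h.2, h.1.2⟩, fun h => ⟨⟨hS h.1, h.2⟩, h.1⟩⟩
  have hi : inEdges E e.2 ∩ S = inEdges S e.2 := by
    ext a; simp only [inEdges, Finset.mem_inter, Finset.mem_filter]
    exact ⟨fun h => ⟨h.2, h.1.2⟩, fun h => ⟨⟨hS h.1, h.2⟩, h.1⟩⟩
  rw [ho] at hout hout'
  rw [hi] at hin hin'
  -- All these edges share the origin `e.1`, so taking `a` to be its own `p` makes that deviation
  -- zero; symmetrically for `h2`.
  have h1 := abs_fracLabel_one_sub_le (a := ((z e.1).1 : ℝ)) hQ hout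
    (by
      rw [Finset.sum_eq_zero]
      · rw [abs_zero]; positivity
      · intro a ha; rw [(Finset.mem_filter.1 ha).2, sub_self]) hout'
  have h2 := abs_fracLabel_one_sub_le (b := ((z e.2).2 : ℝ)) hQ hin hin'
    (by
      rw [Finset.sum_eq_zero]
      · rw [abs_zero]; positivity
      · intro a ha; rw [(Finset.mem_filter.1 ha).2, sub_self])
  have h3 := abs_fracLabel_one_sub_le hQ hL hL₁ hL₂
  unfold predict bayes trollness untrust
  rw [one_sub_fracLabel_neg_one (hQ.trans_le hout.1)
      fun a ha => hy a (hS (Finset.mem_filter.1 ha).1),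
    one_sub_fracLabel_neg_one (hQ.trans_le hin.1)
      fun a ha => hy a (hS (Finset.mem_filter.1 ha).1)]
  refine sign_eq_sign_of_abs_sub_lt (lt_of_le_of_lt ?_ he)
  unfold eta
  rw [abs_le] at *
  constructor <;> linarith [h1.1, h1.2, h2.1, h2.2, h3.1, h3.2]

end Deterministic

/-! ### Union bound over nodes -/

namespace IsModel

variable {V : Type*} [Fintype V] [DecidableEq V] {Ω : Type*} [MeasurableSpace Ω]
  {P : Measure Ω} [IsProbabilityMeasure P] {E EL : Finset (V × V)} {m : ℕ}
  {μ : Measure (unitInterval × unitInterval)} [IsProbabilityMeasure μ]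
  {x : Ω → Params V} {y : Ω → V × V → SignType} {E₀ : Ω → Finset (V × V)}

theorem le_measureReal_predict_eq_bayes [Nonempty V] (h : IsModel P E m μ x y E₀) (hm : m ≤ E.card)
    {α ε Q : ℝ} (hα₀ : 0 < α) (hα : α * E.card ≤ m) (hε : 0 < ε) (hε' : 2 * ε ^ 2 ≤ 1 / 4)
    (hQ : 0 < Q) (hL : IsLinkSet E EL) (hLQ : 2 * Q / α ≤ EL.card) :
    1 - 17 * (Fintype.card V * Real.exp (-(2 * ε ^ 2 * Q))) ≤ P.real {ω | ∀ e ∈ E \ E₀ ω,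
        2 * Q / α ≤ (outEdges E e.1).card → 2 * Q / α ≤ (inEdges E e.2).card →
        8 * ε < |eta (x ω) e - 1 / 2| → predict EL (E₀ ω) (y ω) e = bayes (x ω) e} := by
  classical
  have hE : 0 < E.card := by
    have : (0 : ℝ) < EL.card := lt_of_lt_of_le (by positivity) hLQ
    exact (Nat.cast_pos.1 this).trans_le (Finset.card_le_card hL.1)
  have hdiv (D : Finset (V × V)) (hD : 2 * Q / α ≤ D.card) : 2 * Q ≤ α * D.card := by
    rwa [div_le_iff₀' hα₀] at hD
  set t := Real.exp (-(2 * ε ^ 2 * Q))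
  have hf₁ : Measurable fun a : unitInterval × unitInterval => (a.1 : ℝ) := by fun_prop
  have hf₂ : Measurable fun a : unitInterval × unitInterval => (a.2 : ℝ) := by fun_prop
  set N : Set Ω := {ω | ¬ (E₀ ω ∈ E.powersetCard m ∧ ∃ b, ∀ e ∈ E, y ω e = signLabel E b e)}
  have hN : P.real N = 0 := by
    rw [measureReal_def, ae_iff.1 (h.ae_support hm), ENNReal.toReal_zero]
  set O : V → Set Ω := fun i => {ω | 2 * Q / α ≤ (outEdges E i).card ∧
    ¬ (LabelsConcentrated Q ε (outEdges E i ∩ E₀ ω) (x ω) (y ω) ∧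
      ParamsConcentrated μ ε (fun a => a.2) Prod.snd (outEdges E i ∩ E₀ ω) (x ω))}
  have hO (i : V) : P.real (O i) ≤ 5 * t := by
    by_cases hd : 2 * Q / α ≤ (outEdges E i).card
    · refine (measureReal_mono fun ω hω => hω.2).trans
        (h.measureReal_not_concentrated_le hm hα hE hε hε' hQ (Finset.filter_subset _ _)
        (hdiv _ hd) hf₂ (fun a => a.2.2) ?_)
      intro a ha b hb hab
      exact Prod.ext ((Finset.mem_filter.1 ha).2.trans (Finset.mem_filter.1 hb).2.symm) hab
    · have : O i = ∅ := Set.eq_empty_of_forall_notMem fun ω hω => hd hω.1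
      rw [this, measureReal_empty]; positivity
  set I : V → Set Ω := fun j => {ω | 2 * Q / α ≤ (inEdges E j).card ∧
    ¬ (LabelsConcentrated Q ε (inEdges E j ∩ E₀ ω) (x ω) (y ω) ∧
      ParamsConcentrated μ ε (fun a => a.1) Prod.fst (inEdges E j ∩ E₀ ω) (x ω))}
  have hI (j : V) : P.real (I j) ≤ 5 * t := by
    by_cases hd : 2 * Q / α ≤ (inEdges E j).card
    · refine (measureReal_mono fun ω hω => hω.2).trans
        (h.measureReal_not_concentrated_le hm hα hE hε hε' hQ (Finset.filter_subset _ _)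
        (hdiv _ hd) hf₁ (fun a => a.1.2) ?_)
      intro a ha b hb hab
      exact Prod.ext hab ((Finset.mem_filter.1 ha).2.trans (Finset.mem_filter.1 hb).2.symm)
    · have : I j = ∅ := Set.eq_empty_of_forall_notMem fun ω hω => hd hω.1
      rw [this, measureReal_empty]; positivity
  set L₁ : Set Ω := {ω | ¬ (LabelsConcentrated Q ε (EL ∩ E₀ ω) (x ω) (y ω) ∧
      ParamsConcentrated μ ε (fun a => a.1) Prod.fst (EL ∩ E₀ ω) (x ω))}
  have hL₁ : P.real L₁ ≤ 5 * t := h.measureReal_not_concentrated_le hm hα hE hε hε' hQ hL.1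
    (hdiv _ hLQ) hf₁ (fun a => a.1.2) hL.2.1
  -- The sample size and the labels on `EL` are already charged to `L₁`, so only one more Hoeffding
  -- tail is paid.
  set L₂ : Set Ω := {ω | Q ≤ (EL ∩ E₀ ω).card ∧
      ¬ ParamsConcentrated μ ε (fun a => a.2) Prod.snd (EL ∩ E₀ ω) (x ω)}
  have hL₂ : P.real L₂ ≤ 2 * t := h.measureReal_params_deviate_le hm hε hQ
    hf₂ (fun a => a.2.2) hL.2.2
  set G : Set Ω := {ω | ∀ e ∈ E \ E₀ ω,
        2 * Q / α ≤ (outEdges E e.1).card → 2 * Q / α ≤ (inEdges E e.2).card →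
        8 * ε < |eta (x ω) e - 1 / 2| → predict EL (E₀ ω) (y ω) e = bayes (x ω) e}
  -- Covering the whole space and using subadditivity avoids any measurability of `G`.
  have hcover : Set.univ ⊆ G ∪ (N ∪ ((⋃ i ∈ Finset.univ, O i) ∪ ((⋃ j ∈ Finset.univ, I j) ∪
      (L₁ ∪ L₂)))) := by
    intro ω _
    by_contra hω
    simp only [Set.mem_union, not_or, Set.mem_iUnion, Finset.mem_univ, exists_const,
      not_exists] at hω
    obtain ⟨hG, hNω, hOω, hIω, hL₁ω, hL₂ω⟩ := hω
    refine hG fun e _ hdo hdi hη => ?_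
    obtain ⟨hS, b, hb⟩ := not_not.1 hNω
    obtain ⟨hl, hl₁⟩ := not_not.1 hL₁ω
    have ho := not_not.1 fun hn => hOω e.1 ⟨hdo, hn⟩
    have hi := not_not.1 fun hn => hIω e.2 ⟨hdi, hn⟩
    have hl₂ := not_not.1 fun hn => hL₂ω ⟨hl.1, hn⟩
    refine predict_eq_bayes hQ (Finset.mem_powersetCard.1 hS).1 (fun a ha => ?_)
      ho.1 ho.2 hi.1 hi.2 hl hl₁ hl₂ hε hη
    rw [hb a ha, signLabel, dif_pos ha]
    split_ifs <;> decide
  have hsum {A : V → Set Ω} (hA : ∀ i, P.real (A i) ≤ 5 * t) :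
      P.real (⋃ i ∈ Finset.univ, A i) ≤ Fintype.card V * (5 * t) := by
    refine (measureReal_biUnion_finset_le _ _).trans ((Finset.sum_le_sum fun i _ => hA i).trans ?_)
    simp
  have hcard : (1 : ℝ) ≤ Fintype.card V := by exact_mod_cast Fintype.card_pos
  -- The failures total `(10n + 7)t` for `n` nodes, at most `17nt` since `n ≥ 1`.
  have ht : t ≤ Fintype.card V * t := le_mul_of_one_le_left (Real.exp_pos _).le hcard
  have h1 : (1 : ℝ) ≤ _ := probReal_univ (μ := P) ▸ measureReal_mono hcover
  have u1 := measureReal_union_le (μ := P) G (N ∪ ((⋃ i ∈ Finset.univ, O i) ∪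
    ((⋃ j ∈ Finset.univ, I j) ∪ (L₁ ∪ L₂))))
  have u2 := measureReal_union_le (μ := P) N ((⋃ i ∈ Finset.univ, O i) ∪
    ((⋃ j ∈ Finset.univ, I j) ∪ (L₁ ∪ L₂)))
  have u3 := measureReal_union_le (μ := P) (⋃ i ∈ Finset.univ, O i)
    ((⋃ j ∈ Finset.univ, I j) ∪ (L₁ ∪ L₂))
  have u4 := measureReal_union_le (μ := P) (⋃ j ∈ Finset.univ, I j) (L₁ ∪ L₂)
  have u5 := measureReal_union_le (μ := P) L₁ L₂
  linarith [hsum hO, hsum hI]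

end IsModel

end EdgeSign

/-! ### Choice of constants -/

theorem theorem1 :
    -- quantitative form
    (∀ (V : Type*) [Fintype V] [DecidableEq V] (E EL : Finset (V × V)) (m : ℕ) (α δ ε Q : ℝ)
      (Ω : Type*) [MeasurableSpace Ω] (P : Measure Ω) [IsProbabilityMeasure P]
      (μ : Measure (unitInterval × unitInterval)) [IsProbabilityMeasure μ]
      (x : Ω → EdgeSign.Params V) (y : Ω → V × V → SignType) (E₀ : Ω → Finset (V × V)),
      0 < α → α < 1 → 0 < δ → δ < 1 → 0 < ε → ε < 1 / 16 →
      1 / (2 * ε ^ 2) * Real.log (4 * (Fintype.card V : ℝ) / δ) ≤ Q →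
      EdgeSign.IsLinkSet E EL → 2 * Q / α ≤ (EL.card : ℝ) →
      α * (E.card : ℝ) ≤ (m : ℝ) → m ≤ E.card →
      EdgeSign.IsModel P E m μ x y E₀ →
      1 - 11 * δ ≤ P.real {ω | ∀ e ∈ E \ E₀ ω,
        2 * Q / α ≤ ((EdgeSign.outEdges E e.1).card : ℝ) →
        2 * Q / α ≤ ((EdgeSign.inEdges E e.2).card : ℝ) →
        8 * ε < |EdgeSign.eta (x ω) e - 1 / 2| →
        EdgeSign.predict EL (E₀ ω) (y ω) e = EdgeSign.bayes (x ω) e}) ∧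
    -- asymptotic form
    (∀ γ c : ℝ, 0 < γ → 0 < c → ∃ C : ℝ, 0 < C ∧
      ∀ (V : Type*) [Fintype V] [DecidableEq V] (E EL : Finset (V × V)) (m : ℕ) (α Q : ℝ)
        (Ω : Type*) [MeasurableSpace Ω] (P : Measure Ω) [IsProbabilityMeasure P]
        (μ : Measure (unitInterval × unitInterval)) [IsProbabilityMeasure μ]
        (x : Ω → EdgeSign.Params V) (y : Ω → V × V → SignType) (E₀ : Ω → Finset (V × V)),
        0 < α → α < 1 →
        C * Real.log (Fintype.card V : ℝ) ≤ Q →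
        EdgeSign.IsLinkSet E EL → 2 * Q / α ≤ (EL.card : ℝ) →
        α * (E.card : ℝ) ≤ (m : ℝ) → m ≤ E.card →
        EdgeSign.IsModel P E m μ x y E₀ →
        1 - (Fintype.card V : ℝ) ^ (-c) ≤ P.real {ω | ∀ e ∈ E \ E₀ ω,
          C / α * Real.log (Fintype.card V : ℝ) ≤ ((EdgeSign.outEdges E e.1).card : ℝ) →
          C / α * Real.log (Fintype.card V : ℝ) ≤ ((EdgeSign.inEdges E e.2).card : ℝ) →
          γ ≤ |EdgeSign.eta (x ω) e - 1 / 2| →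
          EdgeSign.predict EL (E₀ ω) (y ω) e = EdgeSign.bayes (x ω) e}) := by
  refine ⟨?_, ?_⟩
  · intro V _ _ E EL m α δ ε Q Ω _ P _ μ _ x y E₀ hα₀ _ hδ hδ₁ hε hε₁ hQ hL hLQ hα hm h
    cases isEmpty_or_nonempty V
    · have : {ω | ∀ e ∈ E \ E₀ ω, 2 * Q / α ≤ ((EdgeSign.outEdges E e.1).card : ℝ) →
          2 * Q / α ≤ ((EdgeSign.inEdges E e.2).card : ℝ) →
          8 * ε < |EdgeSign.eta (x ω) e - 1 / 2| →
          EdgeSign.predict EL (E₀ ω) (y ω) e = EdgeSign.bayes (x ω) e} = Set.univ :=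
        Set.eq_univ_of_forall fun ω e => isEmptyElim e.1
      rw [this, probReal_univ]
      linarith
    have hn : (1 : ℝ) ≤ Fintype.card V := by exact_mod_cast Fintype.card_pos
    have hpos : (0 : ℝ) < 4 * Fintype.card V / δ := by positivity
    have hlog : 0 < Real.log (4 * Fintype.card V / δ) :=
      Real.log_pos ((one_lt_div hδ).2 (by linarith))
    have hQ₀ : 0 < Q := lt_of_lt_of_le (by positivity) hQ
    refine le_trans ?_ (h.le_measureReal_predict_eq_bayes hm hα₀ hα hε (by nlinarith) hQ₀ hL hLQ)
    have hexp : Real.exp (-(2 * ε ^ 2 * Q)) ≤ δ / (4 * Fintype.card V) := by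
      rw [← inv_div, ← Real.exp_log hpos, ← Real.exp_neg, Real.exp_le_exp, neg_le_neg_iff]
      rwa [one_div_mul_eq_div, div_le_iff₀' (by positivity)] at hQ
    -- The total failure is then at most `17δ/4`, below `11δ`.
    have : (Fintype.card V : ℝ) * Real.exp (-(2 * ε ^ 2 * Q)) ≤ δ / 4 := by
      calc _ ≤ (Fintype.card V : ℝ) * (δ / (4 * Fintype.card V)) := by gcongr
        _ = _ := by field_simp
    linarith
  · intro γ c hγ hc
    -- The factor `1/10` turns the weak margin `γ` into a strict `8ε < γ`; the cap `1/20` ensures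
    -- `2ε² ≤ 1/4`.
    set ε := min (γ / 10) (1 / 20)
    have hε : 0 < ε := lt_min (by positivity) (by norm_num)
    have hεγ : 8 * ε < γ := by linarith [min_le_left (γ / 10) (1 / 20 : ℝ)]
    have hε₁ : ε ≤ 1 / 20 := min_le_right _ _
    -- With `Q = K log n` the Hoeffding tail is `n^(-6-c)`: one power of `n` pays for the union
    -- bound, and `n^5 ≥ 32` beats `17` when `n ≥ 2`.
    set K := (6 + c) / (2 * ε ^ 2)
    have hK : 0 < K := by positivity
    refine ⟨2 * K, by positivity, ?_⟩
    intro V _ _ E EL m α Q Ω _ P _ μ _ x y E₀ hα₀ _ hQ hL hLQ hα hm h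
    rcases Nat.lt_trichotomy (Fintype.card V) 1 with hn | hn | hn
    · have : IsEmpty V := Fintype.card_eq_zero_iff.1 (by omega)
      have : {ω | ∀ e ∈ E \ E₀ ω,
          2 * K / α * Real.log (Fintype.card V : ℝ) ≤ ((EdgeSign.outEdges E e.1).card : ℝ) →
          2 * K / α * Real.log (Fintype.card V : ℝ) ≤ ((EdgeSign.inEdges E e.2).card : ℝ) →
          γ ≤ |EdgeSign.eta (x ω) e - 1 / 2| →
          EdgeSign.predict EL (E₀ ω) (y ω) e = EdgeSign.bayes (x ω) e} = Set.univ :=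
        Set.eq_univ_of_forall fun ω e => isEmptyElim e.1
      rw [this, probReal_univ]
      linarith [Real.rpow_nonneg (Nat.cast_nonneg (α := ℝ) (Fintype.card V)) (-c)]
    -- For one node the logarithm vanishes and `Q` need not be positive, but the claimed lower bound
    -- is `0`.
    · rw [hn, Nat.cast_one, Real.one_rpow, sub_self]
      exact measureReal_nonneg
    · have : Nonempty V := Fintype.card_pos_iff.1 (by omega)
      have hn₂ : (2 : ℝ) ≤ Fintype.card V := by exact_mod_cast hn
      have hn₀ : (0 : ℝ) < Fintype.card V := by linarith
      set l := Real.log (Fintype.card V)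
      have hl : 0 < l := Real.log_pos (by linarith)
      -- The estimate is applied with `K * l` in place of the given `Q`, so that its degree
      -- threshold is exactly `C/α · log n` with `C = 2K`.
      have hLK : 2 * (K * l) / α ≤ EL.card := by
        refine le_trans ?_ hLQ
        gcongr
        nlinarith [mul_pos hK hl]
      have hd : 2 * K / α * l = 2 * (K * l) / α := by ring
      refine le_trans ?_ ((h.le_measureReal_predict_eq_bayes (Q := K * l) hm hα₀ hα hε
        (by nlinarith) (by positivity) hL hLK).trans (measureReal_mono ?_))
      · have hexp : Real.exp (-(2 * ε ^ 2 * (K * l))) =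
            (Fintype.card V : ℝ) ^ (-c) * ((Fintype.card V : ℝ) ^ 6)⁻¹ := by
          have : 2 * ε ^ 2 * (K * l) = (6 + c) * l := by
            simp only [K]; field_simp
          rw [this, Real.rpow_def_of_pos hn₀, ← Real.exp_log (pow_pos hn₀ 6), ← Real.exp_neg,
            ← Real.exp_add, Real.log_pow]
          congr 1
          push_cast
          ring
        have hp : (0 : ℝ) ≤ (Fintype.card V : ℝ) ^ (-c) := Real.rpow_nonneg hn₀.le _
        have h32 : (32 : ℝ) ≤ (Fintype.card V : ℝ) ^ 5 := by
          calc (32 : ℝ) = 2 ^ 5 := by norm_num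
            _ ≤ _ := by gcongr
        have : 17 * ((Fintype.card V : ℝ) * Real.exp (-(2 * ε ^ 2 * (K * l)))) =
            (17 / (Fintype.card V : ℝ) ^ 5) * (Fintype.card V : ℝ) ^ (-c) := by
          rw [hexp]; field_simp
        rw [this]
        have h17 : 17 / (Fintype.card V : ℝ) ^ 5 ≤ 1 := by
          rw [div_le_one (by positivity)]; linarith
        linarith [mul_le_mul_of_nonneg_right h17 hp]
      · intro ω hω e he h1 h2 h3
        exact hω e he (hd ▸ h1) (hd ▸ h2) (hεγ.trans_le h3)
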